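/- **Proposition 3.1.** Let $m,n\ge 1$, $d=m+n$, and let $w_1,\dots,w_{d}>0$ satisfy $\sum_{i=1}^m w_i=\sum_{j=1}^n w_{m+j}$. For $t\in\mathbb R$ and $\theta\in \mathrm M_{m\times n}(\mathbb R)$ put $$a_t=\operatorname{diag}(e^{w_1t},\dots,e^{w_mt},e^{-w_{m+1}t},\dots,e^{-w_{m+n}t}),\qquad u(\theta)=\begin{pmatrix} I_m&\theta\\0&I_n\end{pmatrix}.$$ Let $\tilde G=\mathrm{SL}_d(\mathbb R)\ltimes\mathbb R^d$, with elements $[g,b]$ multiplied by $[g,b][g',b']=[gg',b+gb']$, let $\tilde\Gamma=\mathrm{SL}_d(\mathbb Z)\ltimes\mathbb Z^d$, and let $\|\cdot\|$ be the sup norm on $\mathbb R^d$. A vector $\xi\in\mathbb R^d$ is called Liouville if for every $E>0$ there are infinitely many $(p,q)\in\mathbb Z^d\times\{1,2,3,\dots\}$ with $\|\xi-p/q\|<q^{-E}$. Let $y=[g,gv]\tilde\Gamma\in\tilde G/\tilde\Gamma$, where $g\in \mathrm{SL}_d(\mathbb R)$ and $v\in\mathbb R^d$ is not Liouville, and let $L>0$.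 Then there are constants $\beta_0,\beta_1,\beta_2>0$, depending only on $m$, $n$, the weights $w_i$, $y$ and $L$, such that for all $t\ge 0$ and all $0<A<1<B$, the set $S$ of all $\theta\in \mathrm M_{m\times n}([-L,L])$ for which the lattice $$\begin{pmatrix} a_tu(\theta)&0\\0&1\end{pmatrix}\begin{pmatrix} g&gv\\0&1\end{pmatrix}\mathbb Z^{d+1}$$ contains a nonzero vector $(x,s)\in\mathbb R^d\times\mathbb R$ with $\|x\|\le A$ and $|s|\le B$ has Lebesgue measure $$|S|\le \beta_0\,A^{\beta_1}B^{\beta_2}.$$ -/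

import Mathlib

open scoped Matrix MatrixGroups

noncomputable section

/-- `ξ ∈ ℝ^ι` is a Liouville vector: for every `E > 0` there are infinitely many
`(p, q) ∈ ℤ^ι × {1, 2, …}` with `‖ξ - p / q‖ < 1 / q ^ E` (sup norm). -/
def IsLiouvilleVector {ι : Type*} [Fintype ι] (ξ : ι → ℝ) : Prop :=
  ∀ E : ℝ, 0 < E →
    {pq : (ι → ℤ) × ℕ |
      1 ≤ pq.2 ∧ ‖ξ - fun i => (pq.1 i : ℝ) / (pq.2 : ℝ)‖ < 1 / (pq.2 : ℝ) ^ E}.Infinite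

section AffineGroup

variable (ι : Type*) [Fintype ι] [DecidableEq ι]

/-- The linear action of `SL_ι(ℝ)` on the additive group `ℝ^ι`. -/
def linAction : Matrix.SpecialLinearGroup ι ℝ →* MulAut (Multiplicative (ι → ℝ)) where
  toFun g := AddEquiv.toMultiplicative (Matrix.SpecialLinearGroup.toLin' g).toAddEquiv
  map_one' := by ext x; simp
  map_mul' g h := by ext x; simp

/-- The affine group `SL_ι(ℝ) ⋉ ℝ^ι`, with `[g, b] * [g', b'] = [g * g', b + g b']`. -/
abbrev AffineSL : Type _ :=
  Multiplicative (ι → ℝ) ⋊[linAction ι] Matrix.SpecialLinearGroup ι ℝ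

variable {ι}

/-- The element `[g, b]` of `SL_ι(ℝ) ⋉ ℝ^ι`. -/
def affineElt (g : Matrix.SpecialLinearGroup ι ℝ) (b : ι → ℝ) : AffineSL ι :=
  ⟨Multiplicative.ofAdd b, g⟩

theorem affineElt_mul (g g' : Matrix.SpecialLinearGroup ι ℝ) (b b' : ι → ℝ) :
    affineElt g b * affineElt g' b' =
      affineElt (g * g') (b + (g : Matrix ι ι ℝ) *ᵥ b') := by
  rfl

variable (ι)

/-- The subgroup `SL_ι(ℤ) ⋉ ℤ^ι` of `SL_ι(ℝ) ⋉ ℝ^ι`. -/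
def affineSLInt : Subgroup (AffineSL ι) where
  carrier := {x | ∃ (γ : Matrix.SpecialLinearGroup ι ℤ) (k : ι → ℤ),
    x = affineElt (Matrix.SpecialLinearGroup.map (Int.castRingHom ℝ) γ) (fun i => (k i : ℝ))}
  one_mem' := ⟨1, 0, by simp; rfl⟩
  mul_mem' := by
    rintro _ _ ⟨γ, k, rfl⟩ ⟨γ', k', rfl⟩
    refine ⟨γ * γ', k + (γ : Matrix ι ι ℤ) *ᵥ k', ?_⟩
    rw [affineElt_mul, map_mul]
    congr 1
    ext i
    simp [Matrix.mulVec, dotProduct]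
  inv_mem' := by
    rintro _ ⟨γ, k, rfl⟩
    refine ⟨γ⁻¹, -(((γ⁻¹ : Matrix.SpecialLinearGroup ι ℤ) : Matrix ι ι ℤ) *ᵥ k), ?_⟩
    rw [inv_eq_iff_mul_eq_one, affineElt_mul, ← map_mul, mul_inv_cancel, map_one]
    have h : (γ : Matrix ι ι ℤ) *ᵥ
        (-(((γ⁻¹ : Matrix.SpecialLinearGroup ι ℤ) : Matrix ι ι ℤ) *ᵥ k)) = -k := by
      rw [Matrix.mulVec_neg, Matrix.mulVec_mulVec, ← Matrix.SpecialLinearGroup.coe_mul,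
        mul_inv_cancel, Matrix.SpecialLinearGroup.coe_one, Matrix.one_mulVec]
    change affineElt _ _ = affineElt 1 0
    congr 1
    ext i
    have h' := congrArg (fun z : ℤ => (z : ℝ)) (congrFun h i)
    simp only [Matrix.mulVec, dotProduct, Pi.neg_apply, Int.cast_sum, Int.cast_mul,
      Int.cast_neg] at h'
    simp [Matrix.mulVec, dotProduct] at h' ⊢
    linarith

/-- The space of affine unimodular lattices `(SL_ι(ℝ) ⋉ ℝ^ι) / (SL_ι(ℤ) ⋉ ℤ^ι)`. -/
abbrev AffineLatticeSpace : Type _ := AffineSL ι ⧸ affineSLInt ι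

variable {ι}

/-- The matrix `(h, b; 0, 1)` acting on `ℝ^ι × ℝ`. -/
def affineMatrix (h : Matrix ι ι ℝ) (b : ι → ℝ) : Matrix (ι ⊕ Unit) (ι ⊕ Unit) ℝ :=
  Matrix.fromBlocks h (Matrix.replicateCol Unit b) 0 1

/-- The set `M ℤ^κ` of images of integer vectors under a matrix `M`. -/
def integerImage {κ : Type*} [Fintype κ] (M : Matrix κ κ ℝ) : Set (κ → ℝ) :=
  Set.range fun k : κ → ℤ => M *ᵥ fun i => (k i : ℝ)

/-- The cylinder `{(x, y) ∈ ℝ^ι × ℝ : ‖x‖ ≤ A, |y| ≤ B}` (sup norm on `ℝ^ι`). -/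
def thinCylinder (A B : ℝ) : Set (ι ⊕ Unit → ℝ) :=
  {z | ‖fun i => z (Sum.inl i)‖ ≤ A ∧ |z (Sum.inr ())| ≤ B}

end AffineGroup

section Flow

variable {m n : ℕ}

/-- `a_t = diag(e^{w_1 t}, …, e^{w_m t}, e^{-w_{m+1} t}, …, e^{-w_{m+n} t})`. -/
def diagFlow (w : Fin m ⊕ Fin n → ℝ) (t : ℝ) : Matrix (Fin m ⊕ Fin n) (Fin m ⊕ Fin n) ℝ :=
  Matrix.diagonal (Sum.elim (fun i => Real.exp (w (Sum.inl i) * t))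
    (fun j => Real.exp (-(w (Sum.inr j)) * t)))

/-- `u(θ) = (I_m, θ; 0, I_n)`. -/
def unipotent (θ : Fin m → Fin n → ℝ) : Matrix (Fin m ⊕ Fin n) (Fin m ⊕ Fin n) ℝ :=
  Matrix.fromBlocks 1 (Matrix.of θ) 0 1

/-- The set of `θ ∈ M_{m×n}([-L, L])` such that
`diag(a_t u(θ), 1) (g, g v; 0, 1) ℤ^{d+1}` contains a nonzero vector `(x, y)` with
`‖x‖ ≤ A` and `|y| ≤ B`. -/
def cylinderSet (w : Fin m ⊕ Fin n → ℝ) (g : Matrix.SpecialLinearGroup (Fin m ⊕ Fin n) ℝ)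
    (v : Fin m ⊕ Fin n → ℝ) (t L A B : ℝ) : Set (Fin m → Fin n → ℝ) :=
  {θ | (∀ i j, θ i j ∈ Set.Icc (-L) L) ∧
    ∃ z ∈ integerImage (affineMatrix (diagFlow w t * unipotent θ) 0 *
        affineMatrix (g : Matrix (Fin m ⊕ Fin n) (Fin m ⊕ Fin n) ℝ)
          ((g : Matrix (Fin m ⊕ Fin n) (Fin m ⊕ Fin n) ℝ) *ᵥ v)),
      z ≠ 0 ∧ z ∈ thinCylinder A B}

end Flow

end

/-! The proof is a union bound over lattice vectors. If θ lies in S, some x = (x', x'') = g(p + qv)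
with (p, q) ≠ 0 and |q| ≤ B satisfies |x'_i + θ_i · x''| ≤ A e^{-w_i t} and |x''_j| ≤ A e^{w_{m+j}
t}. For a single x these θ have volume O(A^m e^{-(w_1+...+w_m)t} ‖x''‖^{-m}) (`volume_slabSet_le`).
Since θ is bounded, x'' leaves only O((1 + ‖x''‖)^m) integer parts for x', and for fixed q each unit
cube contains boundedly many x. The two powers of ‖x''‖ therefore balance, and the number of integer
parts of x'' cancels the exponential because the weights balance.

The only danger is a short x''. As v is not Liouville, ‖x‖ ≥ 2a with a comparable to B^{-N}
(`exists_diophantine_of_not_isLiouvilleVector`). If A ≤ a, a nonempty slab then forces ‖x''‖ ≥ a /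
(1 + nL) (`le_norm_inr_of_mem_slabSet`), and summing over the O(B) values of q gives |S| = O(B
(A/a)^m) (`volume_cylinderSet_le_of_norm_le`). If A ≥ a, the volume of the whole cube is already
O((A/a)^m). Hence β₁ = m and β₂ = Nm + 1. -/

open MeasureTheory

/-! ### Diophantine exponent of a non-Liouville vector -/

/-- A vector that is not Liouville satisfies a Diophantine inequality with a natural exponent. -/
theorem exists_diophantine_of_not_isLiouvilleVector {ι : Type*} [Fintype ι] {v : ι → ℝ}
    (hv : ¬ IsLiouvilleVector v) :
    ∃ c : ℝ, 0 < c ∧ c ≤ 1 ∧ ∃ N : ℕ, ∀ (p : ι → ℤ) (q : ℤ), q ≠ 0 →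
      c ≤ |(q : ℝ)| ^ N * ‖fun i => (p i : ℝ) + q * v i‖ := by
  unfold IsLiouvilleVector at hv
  push Not at hv
  obtain ⟨E, hE, hfin⟩ := hv
  set F : Set ((ι → ℤ) × ℕ) := {pq | 1 ≤ pq.2 ∧
    ‖v - fun i => (pq.1 i : ℝ) / (pq.2 : ℝ)‖ < 1 / (pq.2 : ℝ) ^ E} with hF
  have hpos : ∀ pq : (ι → ℤ) × ℕ, 1 ≤ pq.2 →
      0 < ‖v - fun i => (pq.1 i : ℝ) / (pq.2 : ℝ)‖ := by
    rintro ⟨p, q⟩ hq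
    simp only at hq
    by_contra h0
    have h0 : v - (fun i => (p i : ℝ) / (q : ℝ)) = 0 := by
      rw [← norm_le_zero_iff]; exact not_lt.1 h0
    -- If v = p/q, all multiples (kp, kq) with k ≥ 1 are exact solutions, against finiteness.
    refine Set.infinite_of_injective_forall_mem (s := F)
      (f := fun k : ℕ => ((fun i => (k + 1 : ℤ) * p i, (k + 1) * q) : (ι → ℤ) × ℕ)) ?_ ?_ hfin
    · intro k l hkl
      have := congrArg Prod.snd hkl
      simp only at this
      have := Nat.eq_of_mul_eq_mul_right (by omega) this
      omega
    · intro k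
      have hkq : 1 ≤ (k + 1) * q := Nat.mul_pos (by omega) (by omega)
      refine ⟨hkq, ?_⟩
      have : v - (fun i => (((k + 1 : ℤ) * p i : ℤ) : ℝ) / (((k + 1) * q : ℕ) : ℝ)) = 0 := by
        rw [← h0]
        ext i
        have hk : ((k : ℝ) + 1) ≠ 0 := by positivity
        simp only [Pi.sub_apply]
        push_cast
        rw [mul_div_mul_left _ _ hk]
      simp only [this, norm_zero]
      have : (0 : ℝ) < (((k + 1) * q : ℕ) : ℝ) := by exact_mod_cast hkq
      positivity
  -- Off the finite set `F` the constant 1 works; on `F` the minimum is attained and positive.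
  obtain ⟨c, hc0, hc1, hc⟩ : ∃ c : ℝ, 0 < c ∧ c ≤ 1 ∧ ∀ pq : (ι → ℤ) × ℕ, 1 ≤ pq.2 →
      c ≤ (pq.2 : ℝ) ^ E * ‖v - fun i => (pq.1 i : ℝ) / (pq.2 : ℝ)‖ := by
    have key : ∀ pq : (ι → ℤ) × ℕ, 1 ≤ pq.2 → pq ∉ F →
        1 ≤ (pq.2 : ℝ) ^ E * ‖v - fun i => (pq.1 i : ℝ) / (pq.2 : ℝ)‖ := by
      intro pq hq hn
      have h1 : ¬ (‖v - fun i => (pq.1 i : ℝ) / (pq.2 : ℝ)‖ < 1 / (pq.2 : ℝ) ^ E) :=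
        fun h => hn ⟨hq, h⟩
      have hq0 : (0 : ℝ) < (pq.2 : ℝ) := by exact_mod_cast hq
      have h2 : (0 : ℝ) < (pq.2 : ℝ) ^ E := Real.rpow_pos_of_pos hq0 E
      rw [not_lt, div_le_iff₀ h2] at h1
      linarith
    by_cases hne : F.Nonempty
    · obtain ⟨a, ha, hmin⟩ := Set.exists_min_image F
        (fun pq => (pq.2 : ℝ) ^ E * ‖v - fun i => (pq.1 i : ℝ) / (pq.2 : ℝ)‖) hfin hne
      have hq0 : (0 : ℝ) < (a.2 : ℝ) := by exact_mod_cast ha.1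
      refine ⟨min 1 ((a.2 : ℝ) ^ E * ‖v - fun i => (a.1 i : ℝ) / (a.2 : ℝ)‖),
        lt_min one_pos (mul_pos (Real.rpow_pos_of_pos hq0 E) (hpos a ha.1)), min_le_left _ _, ?_⟩
      intro pq hq
      by_cases hm : pq ∈ F
      · exact (min_le_right _ _).trans (hmin pq hm)
      · exact (min_le_left _ _).trans (key pq hq hm)
    · refine ⟨1, one_pos, le_rfl, fun pq hq => key pq hq fun h => hne ⟨pq, h⟩⟩
  refine ⟨c, hc0, hc1, ⌈E⌉₊, fun p q hq => ?_⟩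
  have hposq : ∀ (p : ι → ℤ) (q : ℕ), 1 ≤ q →
      c ≤ (q : ℝ) ^ ⌈E⌉₊ * ‖fun i => (p i : ℝ) + q * v i‖ := by
    intro p q hq
    have h := hc (fun i => - p i, q) hq
    have hq1 : (1 : ℝ) ≤ q := by exact_mod_cast hq
    have hvec : (fun i => (p i : ℝ) + q * v i) =
        (q : ℝ) • (v - fun i => ((-p i : ℤ) : ℝ) / (q : ℝ)) := by
      ext i
      simp only [Pi.smul_apply, Pi.sub_apply, smul_eq_mul]
      push_cast
      field_simp
      ring
    rw [hvec, norm_smul, Real.norm_of_nonneg (by positivity)]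
    refine h.trans ?_
    have h1 : (q : ℝ) ^ E ≤ (q : ℝ) ^ ⌈E⌉₊ := by
      rw [← Real.rpow_natCast]
      exact Real.rpow_le_rpow_of_exponent_le hq1 (Nat.le_ceil E)
    refine mul_le_mul h1 ?_ (norm_nonneg _) (by positivity)
    exact le_mul_of_one_le_left (norm_nonneg _) hq1
  obtain ⟨k, rfl | rfl⟩ := Int.eq_nat_or_neg q
  · have := hposq p k (by omega)
    simpa using this
  · have := hposq (fun i => - p i) k (by omega)
    have hvec : (fun i => (p i : ℝ) + ((-(k : ℤ) : ℤ) : ℝ) * v i) =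
        - fun i => ((-p i : ℤ) : ℝ) + k * v i := by
      ext i
      simp only [Pi.neg_apply]
      push_cast
      ring
    rw [hvec, norm_neg]
    simpa using this

/-! ### Counting integer points and union bounds -/

/-- The integer points of the box `∏ [-M i, M i]` (with slightly enlarged integer sides). -/
noncomputable def intBox {ι : Type*} [Fintype ι] [DecidableEq ι] (M : ι → ℝ) : Finset (ι → ℤ) :=
  Fintype.piFinset fun i => Finset.Icc (-⌈M i⌉) ⌈M i⌉

theorem mem_Icc_ceil_of_abs_le {k : ℤ} {M : ℝ} (h : |(k : ℝ)| ≤ M) :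
    k ∈ Finset.Icc (-⌈M⌉) ⌈M⌉ := by
  rw [Finset.mem_Icc, ← abs_le]
  have : ((|k| : ℤ) : ℝ) ≤ ⌈M⌉ := by push_cast; exact h.trans (Int.le_ceil M)
  exact_mod_cast this

/-- The factor 5 absorbs the rounding: 2⌈M⌉ + 1 < 2M + 3 ≤ 5M for M ≥ 1. -/
theorem card_Icc_ceil_le {M : ℝ} (hM : 1 ≤ M) :
    ((Finset.Icc (-⌈M⌉) ⌈M⌉).card : ℝ) ≤ 5 * M := by
  have h0 : 0 ≤ ⌈M⌉ := Int.ceil_nonneg (by linarith)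
  have h1 := Int.ceil_lt_add_one M
  have h2 : ((Finset.Icc (-⌈M⌉) ⌈M⌉).card : ℤ) = 2 * ⌈M⌉ + 1 := by
    rw [Int.card_Icc, Int.toNat_of_nonneg (by omega)]
    ring
  have h3 : ((Finset.Icc (-⌈M⌉) ⌈M⌉).card : ℝ) = 2 * ⌈M⌉ + 1 := by exact_mod_cast h2
  rw [h3]
  linarith

theorem mem_intBox {ι : Type*} [Fintype ι] [DecidableEq ι] {M : ι → ℝ} {k : ι → ℤ}
    (h : ∀ i, |(k i : ℝ)| ≤ M i) : k ∈ intBox M :=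
  Fintype.mem_piFinset.2 fun i => mem_Icc_ceil_of_abs_le (h i)

theorem card_intBox_le {ι : Type*} [Fintype ι] [DecidableEq ι] {M : ι → ℝ} (hM : ∀ i, 1 ≤ M i) :
    ((intBox M).card : ℝ) ≤ ∏ i, (5 * M i) := by
  rw [intBox, Fintype.card_piFinset]
  push_cast
  exact Finset.prod_le_prod (fun i _ => by positivity) fun i _ => card_Icc_ceil_le (hM i)

theorem measure_biUnion_finset_le_ofReal {α κ : Type*} [MeasurableSpace α] {μ : Measure α}
    (s : Finset κ) (f : κ → Set α) {c D : ℝ} (hc : (s.card : ℝ) ≤ c) (hD : 0 ≤ D)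
    (h : ∀ i ∈ s, μ (f i) ≤ ENNReal.ofReal D) : μ (⋃ i ∈ s, f i) ≤ ENNReal.ofReal (c * D) := by
  refine (measure_biUnion_finset_le s f).trans ((Finset.sum_le_card_nsmul s _ _ h).trans ?_)
  rw [nsmul_eq_mul, ← ENNReal.ofReal_natCast, ← ENNReal.ofReal_mul (by positivity)]
  exact ENNReal.ofReal_le_ofReal (by gcongr)

/-! ### Volumes of slabs -/

theorem det_updateRow_one {ι R : Type*} [Fintype ι] [DecidableEq ι] [CommRing R] (j : ι)
    (b : ι → R) : ((1 : Matrix ι ι R).updateRow j b).det = b j := by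
  rw [← Matrix.det_transpose, Matrix.updateCol_transpose.symm, Matrix.transpose_one,
    ← Matrix.cramer_apply, Matrix.cramer_one]
  rfl

/-- The volume of the part of the slab `|a + η · b| ≤ ε` in the cube `[-L, L]^ι`. -/
theorem volume_slab_le {ι : Type*} [Fintype ι] (L : ℝ) (hL : 0 ≤ L) (a : ℝ)
    (b : ι → ℝ) (hb : b ≠ 0) (ε : ℝ) (hε : 0 ≤ ε) :
    volume {η : ι → ℝ | (∀ j, η j ∈ Set.Icc (-L) L) ∧ |a + ∑ j, η j * b j| ≤ ε} ≤
      ENNReal.ofReal ((2 * L) ^ (Fintype.card ι - 1) * (2 * ε) / ‖b‖) := by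
  classical
  have hnb : 0 < ‖b‖ := norm_pos_iff.2 hb
  obtain ⟨j, hj⟩ : ∃ j, ‖b j‖ = ‖b‖ := by
    by_contra! h
    exact lt_irrefl _ ((pi_norm_lt_iff hnb).2 fun i => lt_of_le_of_ne (norm_le_pi_norm b i) (h i))
  -- `T` replaces the coordinate where |b| is largest by η · b. It carries the slab into a box, and
  -- |det T| = ‖b‖.
  set T : (ι → ℝ) →ₗ[ℝ] (ι → ℝ) := Matrix.toLin' ((1 : Matrix ι ι ℝ).updateRow j b) with hT
  have hdet : LinearMap.det T = b j := by rw [hT, LinearMap.det_toLin', det_updateRow_one]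
  have hbj : b j ≠ 0 := by
    rw [← norm_pos_iff, hj]; exact hnb
  have hTj : ∀ η, T η j = ∑ k, η k * b k := by
    intro η
    simp [hT, Matrix.mulVec, dotProduct, mul_comm]
  have hTk : ∀ η k, k ≠ j → T η k = η k := by
    intro η k hk
    simp only [hT, Matrix.toLin'_apply, Matrix.mulVec, Matrix.updateRow_ne hk]
    exact congrFun (Matrix.one_mulVec η) k
  set lo : ι → ℝ := Function.update (fun _ => -L) j (-ε - a)
  set hi : ι → ℝ := Function.update (fun _ => L) j (ε - a)
  have hsub : {η : ι → ℝ | (∀ j, η j ∈ Set.Icc (-L) L) ∧ |a + ∑ j, η j * b j| ≤ ε} ⊆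
      T ⁻¹' Set.Icc lo hi := by
    rintro η ⟨h1, h2⟩
    rw [abs_le] at h2
    refine ⟨fun k => ?_, fun k => ?_⟩ <;> by_cases hk : k = j
    · subst hk; rw [hTj]; simp only [lo, Function.update_self]; linarith
    · rw [hTk _ _ hk]; simp only [lo, Function.update_of_ne hk]; exact (h1 k).1
    · subst hk; rw [hTj]; simp only [hi, Function.update_self]; linarith
    · rw [hTk _ _ hk]; simp only [hi, Function.update_of_ne hk]; exact (h1 k).2
  refine (measure_mono hsub).trans ?_
  rw [Measure.addHaar_preimage_linearMap _ (by rw [hdet]; exact hbj), hdet, Real.volume_Icc_pi]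
  have hlen : ∀ k, hi k - lo k = Function.update (fun _ => 2 * L) j (2 * ε) k := by
    intro k
    by_cases hk : k = j
    · subst hk; simp only [hi, lo, Function.update_self]; ring
    · simp only [hi, lo, Function.update_of_ne hk]; ring
  rw [← ENNReal.ofReal_prod_of_nonneg, ← ENNReal.ofReal_mul (abs_nonneg _)]
  · refine ENNReal.ofReal_le_ofReal (le_of_eq ?_)
    simp_rw [hlen]
    rw [Finset.prod_update_of_mem (Finset.mem_univ j), Finset.prod_const,
      Finset.card_sdiff_of_subset (Finset.subset_univ _), Finset.card_univ, Finset.card_singleton,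
      abs_inv, ← Real.norm_eq_abs, hj]
    field_simp
  · intro k _
    rw [hlen]
    by_cases hk : k = j
    · subst hk; rw [Function.update_self]; positivity
    · rw [Function.update_of_ne hk]; positivity

/-- The matrices `θ` with entries in `[-L, L]` such that each row `i` lies in the slab
`|x' i + θ i · x''| ≤ ε i`, where `x = (x', x'')`. -/
def slabSet {m n : ℕ} (L : ℝ) (ε : Fin m → ℝ) (x : Fin m ⊕ Fin n → ℝ) :
    Set (Fin m → Fin n → ℝ) :=
  {θ | (∀ i j, θ i j ∈ Set.Icc (-L) L) ∧
    ∀ i, |x (Sum.inl i) + ∑ j, θ i j * x (Sum.inr j)| ≤ ε i}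

/-- The rows of θ are constrained independently, so the volume is at most a product of m slab
volumes. -/
theorem volume_slabSet_le {m n : ℕ} {L : ℝ} (hL : 0 ≤ L) {ε : Fin m → ℝ} (hε : ∀ i, 0 ≤ ε i)
    (x : Fin m ⊕ Fin n → ℝ) {r : ℝ} (hr : 0 < r) (hx : r ≤ ‖fun j => x (Sum.inr j)‖) :
    volume (slabSet L ε x) ≤
      ENNReal.ofReal (∏ i, ((2 * L) ^ (n - 1) * (2 * ε i) / r)) := by
  have hpi : slabSet L ε x ⊆ Set.univ.pi fun i =>
      {η : Fin n → ℝ | (∀ j, η j ∈ Set.Icc (-L) L) ∧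
        |x (Sum.inl i) + ∑ j, η j * x (Sum.inr j)| ≤ ε i} :=
    fun θ h i _ => ⟨h.1 i, h.2 i⟩
  refine (measure_mono hpi).trans ?_
  rw [volume_pi_pi, ENNReal.ofReal_prod_of_nonneg]
  · refine Finset.prod_le_prod' fun i _ => ?_
    have h0 : (fun j => x (Sum.inr j)) ≠ 0 := norm_pos_iff.1 (hr.trans_le hx)
    refine (volume_slab_le L hL _ _ h0 (ε i) (hε i)).trans (ENNReal.ofReal_le_ofReal ?_)
    rw [Fintype.card_fin]
    have := hε i
    gcongr
  · intro i _
    have := hε i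
    positivity

theorem volume_cube_le {m n : ℕ} {L : ℝ} (hL : 0 ≤ L) :
    volume {θ : Fin m → Fin n → ℝ | ∀ i j, θ i j ∈ Set.Icc (-L) L} ≤
      ENNReal.ofReal (((2 * L) ^ n) ^ m) := by
  have : {θ : Fin m → Fin n → ℝ | ∀ i j, θ i j ∈ Set.Icc (-L) L} =
      Set.univ.pi fun _ => Set.univ.pi fun _ => Set.Icc (-L) L := by
    ext θ; simp only [Set.mem_ofPred_eq, Set.mem_pi, Set.mem_univ, true_imp_iff]
  rw [this, volume_pi_pi]
  simp only [volume_pi_pi, Real.volume_Icc, Finset.prod_const, Finset.card_univ, Fintype.card_fin,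
    sub_neg_eq_add, ← two_mul]
  rw [ENNReal.ofReal_pow (by positivity), ENNReal.ofReal_pow (by positivity)]

/-! ### Lattice vectors and independence of the representative -/

theorem mem_integerImage_affineMatrix {ι : Type*} [Fintype ι] [DecidableEq ι]
    (X g : Matrix ι ι ℝ) (v : ι → ℝ) (z : ι ⊕ Unit → ℝ) :
    z ∈ integerImage (affineMatrix X 0 * affineMatrix g (g *ᵥ v)) ↔
      ∃ (p : ι → ℤ) (q : ℤ),
        z = Sum.elim (X *ᵥ (g *ᵥ fun i => (p i : ℝ) + q * v i)) (fun _ => (q : ℝ)) := by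
  have key : ∀ k : ι ⊕ Unit → ℤ,
      (affineMatrix X 0 * affineMatrix g (g *ᵥ v)) *ᵥ (fun i => (k i : ℝ)) =
        Sum.elim (X *ᵥ (g *ᵥ fun i => (k (Sum.inl i) : ℝ) + k (Sum.inr ()) * v i))
          (fun _ => (k (Sum.inr ()) : ℝ)) := by
    intro k
    have h1 : (fun i => (k (Sum.inl i) : ℝ) + k (Sum.inr ()) * v i) =
        (fun i => (k (Sum.inl i) : ℝ)) + (k (Sum.inr ()) : ℝ) • v := rfl
    rw [← Matrix.mulVec_mulVec, affineMatrix, affineMatrix, Matrix.fromBlocks_mulVec,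
      Matrix.fromBlocks_mulVec, h1, Matrix.mulVec_add, Matrix.mulVec_smul]
    have hz : (Matrix.replicateCol Unit (0 : ι → ℝ)) = 0 := rfl
    have hc : ∀ u : ι → ℝ, (Matrix.replicateCol Unit u) *ᵥ
        ((fun i => (k i : ℝ)) ∘ Sum.inr) = (k (Sum.inr ()) : ℝ) • u := by
      intro u; ext i; simp [Matrix.mulVec, dotProduct, mul_comm]
    rw [hc, hz]
    ext (i | i)
    · simp [Function.comp_def]
      rfl
    · simp
  constructor
  · rintro ⟨k, rfl⟩
    exact ⟨fun i => k (Sum.inl i), k (Sum.inr ()), key k⟩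
  · rintro ⟨p, q, rfl⟩
    exact ⟨Sum.elim p fun _ => q, key _⟩

/-- Two representatives differ on the right by an integral affine map [γ, k], which sends (p, q) to
the integer vector (γp + qk, q); the two lattices therefore coincide. -/
theorem cylinderSet_subset_of_mk_eq {m n : ℕ} (w : Fin m ⊕ Fin n → ℝ)
    {g g' : Matrix.SpecialLinearGroup (Fin m ⊕ Fin n) ℝ} {v v' : Fin m ⊕ Fin n → ℝ}
    (h : (QuotientGroup.mk (affineElt g (g.1 *ᵥ v)) :
        AffineLatticeSpace (Fin m ⊕ Fin n)) =
      QuotientGroup.mk (affineElt g' (g'.1 *ᵥ v'))) (t L A B : ℝ) :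
    cylinderSet w g' v' t L A B ⊆ cylinderSet w g v t L A B := by
  rintro θ ⟨hθ, z, hz, hz0, hzc⟩
  refine ⟨hθ, z, ?_, hz0, hzc⟩
  rw [mem_integerImage_affineMatrix] at hz ⊢
  obtain ⟨p, q, rfl⟩ := hz
  obtain ⟨γ, k, hγ⟩ := QuotientGroup.eq.1 h
  rw [inv_mul_eq_iff_eq_mul, affineElt_mul] at hγ
  have hg : g' = g * Matrix.SpecialLinearGroup.map (Int.castRingHom ℝ) γ :=
    congrArg SemidirectProduct.right hγ
  have hv : g'.1 *ᵥ v' =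
      g.1 *ᵥ v + g.1 *ᵥ fun i => (k i : ℝ) :=
    congrArg (fun a => Multiplicative.toAdd (SemidirectProduct.left a)) hγ
  refine ⟨γ.1 *ᵥ p + q • k, q, ?_⟩
  congr 2
  have h1 : (fun i => (p i : ℝ) + q * v' i) = (fun i => (p i : ℝ)) + (q : ℝ) • v' := rfl
  have h2 : (fun i => (((γ.1 *ᵥ p + q • k) i : ℤ) : ℝ) + q * v i) =
      (Matrix.SpecialLinearGroup.map (Int.castRingHom ℝ) γ).1 *ᵥ
        (fun i => (p i : ℝ)) + (q : ℝ) • (v + fun i => (k i : ℝ)) := by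
    ext i
    simp [Matrix.mulVec, dotProduct]
    ring
  rw [h1, h2, Matrix.mulVec_add, Matrix.mulVec_add, Matrix.mulVec_smul, Matrix.mulVec_smul, hv,
    Matrix.mulVec_mulVec, Matrix.mulVec_add, hg, Matrix.SpecialLinearGroup.coe_mul]

theorem diagFlow_mul_unipotent_mulVec {m n : ℕ} (w : Fin m ⊕ Fin n → ℝ) (t : ℝ)
    (θ : Fin m → Fin n → ℝ) (x : Fin m ⊕ Fin n → ℝ) :
    (diagFlow w t * unipotent θ) *ᵥ x = Sum.elim
      (fun i => Real.exp (w (Sum.inl i) * t) *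
        (x (Sum.inl i) + ∑ j, θ i j * x (Sum.inr j)))
      (fun j => Real.exp (-(w (Sum.inr j)) * t) * x (Sum.inr j)) := by
  rw [← Matrix.mulVec_mulVec, unipotent, Matrix.fromBlocks_mulVec, diagFlow]
  ext (i | j)
  · rw [Matrix.mulVec_diagonal]
    simp [Matrix.mulVec, dotProduct]
  · simp [Matrix.mulVec_diagonal]

/-- A point of `cylinderSet` yields an integer vector `(p, q) ≠ 0` whose image
`x = g (p + q v)` satisfies explicit coordinate inequalities. -/
theorem exists_of_mem_cylinderSet {m n : ℕ} {w : Fin m ⊕ Fin n → ℝ}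
    {g : Matrix.SpecialLinearGroup (Fin m ⊕ Fin n) ℝ} {v : Fin m ⊕ Fin n → ℝ} {t L A B : ℝ}
    {θ : Fin m → Fin n → ℝ} (h : θ ∈ cylinderSet w g v t L A B) :
    ∃ (p : Fin m ⊕ Fin n → ℤ) (q : ℤ), (p ≠ 0 ∨ q ≠ 0) ∧ |(q : ℝ)| ≤ B ∧
      θ ∈ slabSet L (fun i => A * Real.exp (-(w (Sum.inl i) * t)))
        (g.1 *ᵥ fun i => (p i : ℝ) + q * v i) ∧
      ∀ j, |(g.1 *ᵥ fun i => (p i : ℝ) + q * v i) (Sum.inr j)| ≤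
        A * Real.exp (w (Sum.inr j) * t) := by
  obtain ⟨hθ, z, hz, hz0, hzA, hzB⟩ := h
  obtain ⟨p, q, rfl⟩ := (mem_integerImage_affineMatrix _ _ _ _).1 hz
  rw [diagFlow_mul_unipotent_mulVec] at hzA hz0
  set x := g.1 *ᵥ fun i => (p i : ℝ) + q * v i with hx
  simp only [Sum.elim_inl, Sum.elim_inr] at hzA hzB
  refine ⟨p, q, ?_, hzB, ⟨hθ, fun i => ?_⟩, fun j => ?_⟩
  · by_contra! hpq
    apply hz0
    have : x = 0 := by
      rw [hx, hpq.1, hpq.2]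
      convert Matrix.mulVec_zero g.1 using 2
      ext i
      simp
    ext ((i | j) | _) <;> simp [this, hpq.2]
  · have h1 := (norm_le_pi_norm _ (Sum.inl i)).trans hzA
    simp only [Sum.elim_inl, norm_mul, Real.norm_eq_abs, Real.abs_exp] at h1
    change |x (Sum.inl i) + ∑ j, θ i j * x (Sum.inr j)| ≤ A * Real.exp (-(w (Sum.inl i) * t))
    rw [Real.exp_neg, ← div_eq_mul_inv, le_div_iff₀ (Real.exp_pos _), mul_comm]
    exact h1
  · have h1 := (norm_le_pi_norm _ (Sum.inr j)).trans hzA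
    simp only [Sum.elim_inr, norm_mul, Real.norm_eq_abs, Real.abs_exp] at h1
    rw [neg_mul, Real.exp_neg, inv_mul_eq_div, div_le_iff₀ (Real.exp_pos _)] at h1
    exact h1

/-! ### Size of the contributing vectors -/

theorem exists_norm_mulVec_le {ι : Type*} [Fintype ι] (h : Matrix ι ι ℝ) :
    ∃ G : ℝ, 1 ≤ G ∧ ∀ x : ι → ℝ, ‖h *ᵥ x‖ ≤ G * ‖x‖ := by
  refine ⟨max 1 ‖LinearMap.toContinuousLinearMap h.mulVecLin‖, le_max_left _ _, fun x => ?_⟩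
  refine ((LinearMap.toContinuousLinearMap h.mulVecLin).le_opNorm x).trans ?_
  gcongr
  exact le_max_right _ _

theorem abs_sum_mul_le {n : ℕ} {L : ℝ} {η : Fin n → ℝ} (hη : ∀ j, η j ∈ Set.Icc (-L) L)
    (b : Fin n → ℝ) : |∑ j, η j * b j| ≤ n * L * ‖b‖ := by
  calc |∑ j, η j * b j| ≤ ∑ j, |η j * b j| := Finset.abs_sum_le_sum_abs _ _
    _ ≤ ∑ _j : Fin n, L * ‖b‖ := by
        refine Finset.sum_le_sum fun j _ => ?_
        rw [abs_mul]
        exact mul_le_mul (abs_le.2 (hη j)) (norm_le_pi_norm b j) (abs_nonneg _)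
          ((abs_nonneg _).trans (abs_le.2 (hη j)))
    _ = n * L * ‖b‖ := by simp [mul_assoc]

theorem abs_inl_le_of_mem_slabSet {m n : ℕ} {L A : ℝ} {ε : Fin m → ℝ} (hε : ∀ i, ε i ≤ A)
    {x : Fin m ⊕ Fin n → ℝ} {θ : Fin m → Fin n → ℝ} (hθ : θ ∈ slabSet L ε x) (i : Fin m) :
    |x (Sum.inl i)| ≤ A + n * L * ‖fun j => x (Sum.inr j)‖ := by
  have h1 := abs_sum_mul_le (hθ.1 i) fun j => x (Sum.inr j)
  have h2 := (hθ.2 i).trans (hε i)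
  rw [abs_le] at *
  constructor <;> linarith

/-- If a slab of small width around `x = (x', x'')` is nonempty then `x''` is not much smaller
than `x`. -/
theorem le_norm_inr_of_mem_slabSet {m n : ℕ} {L A a : ℝ} (hL : 0 ≤ L) (hA : 0 < A) (hAa : A ≤ a)
    {ε : Fin m → ℝ} (hε : ∀ i, ε i ≤ A) {x : Fin m ⊕ Fin n → ℝ} (hx : 2 * a ≤ ‖x‖)
    {θ : Fin m → Fin n → ℝ} (hθ : θ ∈ slabSet L ε x) :
    a / (1 + n * L) ≤ ‖fun j => x (Sum.inr j)‖ := by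
  rw [div_le_iff₀ (by positivity)]
  by_contra! hlt
  have hnL : 0 ≤ n * L * ‖fun j => x (Sum.inr j)‖ := by positivity
  have hr : ‖fun j => x (Sum.inr j)‖ < a := by linarith
  have h0 : (0 : ℝ) < 2 * a := by linarith
  refine absurd hx (not_le.2 ((pi_norm_lt_iff h0).2 ?_))
  rintro (i | j)
  · refine (abs_inl_le_of_mem_slabSet hε hθ i).trans_lt ?_
    linarith [norm_nonneg fun j => x (Sum.inr j)]
  · refine (norm_le_pi_norm (fun j => x (Sum.inr j)) j).trans_lt ?_
    linarith

/-! ### The union bound -/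

/-- The union bound for the measure of `cylinderSet`, when all nonzero lattice vectors that may
contribute have norm at least `2 * a` with `A ≤ a`. -/
theorem volume_cylinderSet_le_of_norm_le {m n : ℕ} {w : Fin m ⊕ Fin n → ℝ} (hw : ∀ i, 0 < w i)
    (hsum : ∑ i : Fin m, w (Sum.inl i) = ∑ j : Fin n, w (Sum.inr j))
    {g : Matrix.SpecialLinearGroup (Fin m ⊕ Fin n) ℝ} {v : Fin m ⊕ Fin n → ℝ}
    {t L A B G a : ℝ} (ht : 0 ≤ t) (hL : 0 < L) (hA : 0 < A) (hA1 : A < 1) (hB : 1 < B)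
    (hG : 1 ≤ G) (hgG : ∀ x, ‖(g⁻¹).1 *ᵥ x‖ ≤ G * ‖x‖) (hAa : A ≤ a) (ha1 : a ≤ 1)
    (hlow : ∀ (p : Fin m ⊕ Fin n → ℤ) (q : ℤ), (p ≠ 0 ∨ q ≠ 0) → |(q : ℝ)| ≤ B →
      2 * a ≤ ‖g.1 *ᵥ fun i => (p i : ℝ) + q * v i‖) :
    volume (cylinderSet w g v t L A B) ≤ ENNReal.ofReal (5 * B * (10 ^ n *
      ((5 * (G + 1)) ^ (m + n) *
        (5 * (2 + n * L) * (2 * L) ^ (n - 1) * 2 * A * (3 * (1 + n * L)) / a) ^ m))) := by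
  have ha : 0 < a := hA.trans_le hAa
  set ε : Fin m → ℝ := fun i => A * Real.exp (-(w (Sum.inl i) * t)) with hεdef
  have hε0 : ∀ i, 0 < ε i := fun i => by positivity
  have hεA : ∀ i, ε i ≤ A := fun i => by
    have : 0 ≤ w (Sum.inl i) * t := mul_nonneg (hw _).le ht
    exact mul_le_of_le_one_right hA.le (Real.exp_le_one_iff.2 (by linarith))
  -- The 3 makes ρ R ≤ ‖x''‖ follow from ‖x''‖ ≥ σ := a / (1 + nL) when R ≤ 3, and from ‖x''‖ ≥ R -
  -- 2 ≥ R/3 together with σ ≤ 1 when R ≥ 3.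
  set ρ : ℝ := a / (3 * (1 + n * L)) with hρ
  have hρ0 : 0 < ρ := by positivity
  have hρσ : ρ = a / (1 + n * L) / 3 := by rw [hρ]; field_simp
  have hσ1 : a / (1 + n * L) ≤ 1 := by
    rw [div_le_one (by positivity)]
    have : 0 ≤ n * L := by positivity
    linarith
  set R : (Fin n → ℤ) → ℝ := fun z => 1 + ‖fun j => (z j : ℝ)‖ with hR
  have hR1 : ∀ z, 1 ≤ R z := fun z => by simp [hR]
  -- For fixed q, every x = g(p + qv) with integer part z = (z₁, z₂) is some `X q z₂ z₁ k`: p + qv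
  -- is within G of g⁻¹z, so p differs from ⌊g⁻¹z - qv⌋ by a vector k with entries at most G + 1.
  set X : ℤ → (Fin n → ℤ) → (Fin m → ℤ) → (Fin m ⊕ Fin n → ℤ) → (Fin m ⊕ Fin n → ℝ) :=
    fun q z₂ z₁ k => g.1 *ᵥ fun i =>
      ((⌊((g⁻¹).1 *ᵥ fun l => ((Sum.elim z₁ z₂ l : ℤ) : ℝ)) i - q * v i⌋ + k i : ℤ) : ℝ) +
        q * v i with hX
  have hcover : cylinderSet w g v t L A B ⊆
      ⋃ q ∈ Finset.Icc (-⌈B⌉) ⌈B⌉, ⋃ z₂ ∈ intBox fun j => 2 * Real.exp (w (Sum.inr j) * t),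
        ⋃ z₁ ∈ intBox fun _ : Fin m => (2 + n * L) * R z₂,
          ⋃ k ∈ intBox fun _ : Fin m ⊕ Fin n => G + 1,
            {θ | ρ * R z₂ ≤ ‖fun j => X q z₂ z₁ k (Sum.inr j)‖ ∧
              θ ∈ slabSet L ε (X q z₂ z₁ k)} := by
    intro θ hθ
    obtain ⟨p, q, hpq, hq, hslab, hx2⟩ := exists_of_mem_cylinderSet hθ
    set x := g.1 *ᵥ fun i => (p i : ℝ) + q * v i with hx
    have hlo := le_norm_inr_of_mem_slabSet hL.le hA hAa hεA (hlow p q hpq hq) hslab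
    set z₁ : Fin m → ℤ := fun i => ⌊x (Sum.inl i)⌋ with hz₁
    set z₂ : Fin n → ℤ := fun j => ⌊x (Sum.inr j)⌋ with hz₂
    have hfl : ∀ l, |x l - ((Sum.elim z₁ z₂ l : ℤ) : ℝ)| ≤ 1 := by
      have : ∀ l, Sum.elim z₁ z₂ l = ⌊x l⌋ := by rintro (i | j) <;> rfl
      intro l
      rw [this, abs_le]
      constructor <;> linarith [Int.floor_le (x l), Int.lt_floor_add_one (x l)]
    have hd2 : ‖(fun j => x (Sum.inr j)) - fun j => (z₂ j : ℝ)‖ ≤ 1 :=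
      (pi_norm_le_iff_of_nonneg zero_le_one).2 fun j => hfl (Sum.inr j)
    have hxR : ‖fun j => x (Sum.inr j)‖ ≤ R z₂ := by
      have := norm_le_norm_add_norm_sub (fun j => (z₂ j : ℝ)) fun j => x (Sum.inr j)
      rw [norm_sub_rev] at this
      simp only [hR]; linarith
    have hRx : R z₂ - 2 ≤ ‖fun j => x (Sum.inr j)‖ := by
      have := norm_le_norm_add_norm_sub (fun j => x (Sum.inr j)) fun j => (z₂ j : ℝ)
      simp only [hR]; linarith
    set k : Fin m ⊕ Fin n → ℤ := fun i =>
      p i - ⌊((g⁻¹).1 *ᵥ fun l => ((Sum.elim z₁ z₂ l : ℤ) : ℝ)) i - q * v i⌋ with hk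
    have hXx : X q z₂ z₁ k = x := by
      simp only [hX, hk, hx, add_sub_cancel]
    have hinv : (g⁻¹).1 *ᵥ x = fun i => (p i : ℝ) + q * v i := by
      rw [hx, Matrix.mulVec_mulVec]
      have : (g⁻¹).1 * g.1 = 1 := congrArg Subtype.val (inv_mul_cancel g)
      rw [this, Matrix.one_mulVec]
    simp only [Set.mem_iUnion]
    refine ⟨q, mem_Icc_ceil_of_abs_le hq, z₂, mem_intBox fun j => ?_, z₁, mem_intBox fun i => ?_,
      k, mem_intBox fun i => ?_, ?_⟩
    · have h1 := hfl (Sum.inr j)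
      have h2 := hx2 j
      have h3 : A * Real.exp (w (Sum.inr j) * t) ≤ Real.exp (w (Sum.inr j) * t) :=
        mul_le_of_le_one_left (Real.exp_pos _).le hA1.le
      have h4 : 1 ≤ Real.exp (w (Sum.inr j) * t) := Real.one_le_exp (mul_nonneg (hw _).le ht)
      simp only [Sum.elim_inr] at h1
      rw [abs_le] at *
      constructor <;> linarith
    · have h1 := hfl (Sum.inl i)
      have h2 := abs_inl_le_of_mem_slabSet hεA hslab i
      have h3 : n * L * ‖fun j => x (Sum.inr j)‖ ≤ n * L * R z₂ := by gcongr
      have h4 := hR1 z₂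
      simp only [Sum.elim_inl] at h1
      rw [abs_le] at *
      constructor <;> linarith
    · have h1 : ‖(g⁻¹).1 *ᵥ (x - fun l => ((Sum.elim z₁ z₂ l : ℤ) : ℝ))‖ ≤ G := by
        refine (hgG _).trans (mul_le_of_le_one_right (by linarith) ?_)
        exact (pi_norm_le_iff_of_nonneg zero_le_one).2 hfl
      have h2 := (norm_le_pi_norm _ i).trans h1
      rw [Matrix.mulVec_sub, hinv, Pi.sub_apply, Real.norm_eq_abs] at h2
      set y := ((g⁻¹).1 *ᵥ fun l => ((Sum.elim z₁ z₂ l : ℤ) : ℝ)) i with hy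
      have h3 := Int.floor_le (y - q * v i)
      have h4 := Int.lt_floor_add_one (y - q * v i)
      simp only [hk, ← hy]
      push_cast
      rw [abs_le] at *
      constructor <;> linarith
    · rw [hXx]
      refine ⟨?_, hslab⟩
      rw [hρσ]
      have hσ0 : 0 < a / (1 + n * L) := by positivity
      rcases le_total (R z₂) 3 with h3 | h3
      · nlinarith
      · nlinarith
  have hpiece : ∀ q z₂ z₁ k, volume {θ | ρ * R z₂ ≤ ‖fun j => X q z₂ z₁ k (Sum.inr j)‖ ∧
      θ ∈ slabSet L ε (X q z₂ z₁ k)} ≤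
        ENNReal.ofReal (∏ i, ((2 * L) ^ (n - 1) * (2 * ε i) / (ρ * R z₂))) := by
    intro q z₂ z₁ k
    -- Index vectors whose x'' is too short give an empty piece, so the bound holds for all indices.
    by_cases hc : ρ * R z₂ ≤ ‖fun j => X q z₂ z₁ k (Sum.inr j)‖
    · refine (measure_mono fun θ h => h.2).trans
        (volume_slabSet_le hL.le (fun i => (hε0 i).le) _ ?_ hc)
      exact mul_pos hρ0 (by linarith [hR1 z₂])
    · simp [hc]
  have hRpos : ∀ z, 0 < R z := fun z => by linarith [hR1 z]
  have hprodε : ∏ i, ε i = A ^ m * Real.exp (-((∑ i, w (Sum.inl i)) * t)) := by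
    rw [hεdef, Finset.prod_mul_distrib, Finset.prod_const, Finset.card_univ, Fintype.card_fin,
      ← Real.exp_sum, Finset.sum_neg_distrib, Finset.sum_mul]
  -- `D` does not depend on z₂: the R^m choices of z₁ cancel the R^{-m} in the slab volume.
  set D : ℝ := (5 * (G + 1)) ^ (m + n) *
    (5 * (2 + n * L) * (2 * L) ^ (n - 1) * 2 * A * (3 * (1 + n * L)) / a) ^ m *
      Real.exp (-((∑ i, w (Sum.inl i)) * t)) with hD
  have hD0 : 0 ≤ D := by positivity
  have hinner : ∀ q z₂, volume (⋃ z₁ ∈ intBox fun _ : Fin m => (2 + n * L) * R z₂,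
      ⋃ k ∈ intBox fun _ : Fin m ⊕ Fin n => G + 1,
        {θ | ρ * R z₂ ≤ ‖fun j => X q z₂ z₁ k (Sum.inr j)‖ ∧
          θ ∈ slabSet L ε (X q z₂ z₁ k)}) ≤ ENNReal.ofReal D := by
    intro q z₂
    have hRz := hRpos z₂
    have h2 : 1 ≤ (2 + n * L) * R z₂ := by
      have : 0 ≤ n * L := by positivity
      nlinarith [hR1 z₂]
    have hnn : 0 ≤ ∏ i, ((2 * L) ^ (n - 1) * (2 * ε i) / (ρ * R z₂)) :=
      Finset.prod_nonneg fun i _ => by have := hε0 i; positivity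
    refine (measure_biUnion_finset_le_ofReal _ _ (card_intBox_le fun _ => h2)
      (mul_nonneg ?_ hnn) fun z₁ _ =>
        measure_biUnion_finset_le_ofReal _ _ (card_intBox_le fun _ => by linarith) hnn
          fun k _ => hpiece q z₂ z₁ k).trans (ENNReal.ofReal_le_ofReal (le_of_eq ?_))
    · exact Finset.prod_nonneg fun i _ => by linarith
    · have h3 : ∀ i, (2 * L) ^ (n - 1) * (2 * ε i) / (ρ * R z₂) =
          ((2 * L) ^ (n - 1) * 2 / (ρ * R z₂)) * ε i := fun i => by ring
      have h4 : ∏ i, ((2 * L) ^ (n - 1) * (2 * ε i) / (ρ * R z₂)) =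
          ((2 * L) ^ (n - 1) * 2 / (ρ * R z₂)) ^ m *
            (A ^ m * Real.exp (-((∑ i, w (Sum.inl i)) * t))) := by
        simp only [h3]
        rw [Finset.prod_mul_distrib, hprodε, Finset.prod_const, Finset.card_univ, Fintype.card_fin]
      rw [h4, hD, hρ]
      simp only [Finset.prod_const, Finset.card_univ, Fintype.card_fin, Fintype.card_sum]
      rw [show 5 * (2 + n * L) * (2 * L) ^ (n - 1) * 2 * A * (3 * (1 + n * L)) / a =
        (5 * ((2 + n * L) * R z₂)) * ((2 * L) ^ (n - 1) * 2 / (a / (3 * (1 + n * L)) * R z₂)) * A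
        by field_simp, mul_pow _ A, mul_pow (5 * ((2 + n * L) * R z₂))]
      ring
  refine (measure_mono hcover).trans ?_
  have hexp : ∀ j : Fin n, 1 ≤ 2 * Real.exp (w (Sum.inr j) * t) := fun j => by
    have := Real.one_le_exp (mul_nonneg (hw (Sum.inr j)).le ht)
    linarith
  refine (measure_biUnion_finset_le_ofReal _ _ (card_Icc_ceil_le hB.le) (mul_nonneg ?_ hD0)
    fun q _ => measure_biUnion_finset_le_ofReal _ _ (card_intBox_le hexp) hD0
      fun z₂ _ => hinner q z₂).trans (ENNReal.ofReal_le_ofReal (le_of_eq ?_))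
  · exact Finset.prod_nonneg fun j _ => by positivity
  -- The number of z₂ grows like the exponential of the second weight sum times t; by `hsum` this
  -- cancels the decay in `D`.
  · have h1 : ∏ j : Fin n, (5 * (2 * Real.exp (w (Sum.inr j) * t))) =
        10 ^ n * Real.exp ((∑ i, w (Sum.inl i)) * t) := by
      simp only [← mul_assoc]
      rw [Finset.prod_mul_distrib, ← Real.exp_sum, ← Finset.sum_mul, hsum, Finset.prod_const,
        Finset.card_univ, Fintype.card_fin]
      norm_num
    rw [h1, hD, Real.exp_neg]
    have := Real.exp_pos ((∑ i, w (Sum.inl i)) * t)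
    field_simp

/-! ### Choice of the threshold and conclusion -/

theorem exists_volume_cylinderSet_le {m n : ℕ} {w : Fin m ⊕ Fin n → ℝ} (hw : ∀ i, 0 < w i)
    (hsum : ∑ i : Fin m, w (Sum.inl i) = ∑ j : Fin n, w (Sum.inr j))
    (g : Matrix.SpecialLinearGroup (Fin m ⊕ Fin n) ℝ) {v : Fin m ⊕ Fin n → ℝ}
    (hv : ¬ IsLiouvilleVector v) {L : ℝ} (hL : 0 < L) :
    ∃ C : ℝ, 0 < C ∧ ∃ K : ℕ, 0 < K ∧ ∀ t A B : ℝ, 0 ≤ t → 0 < A → A < 1 → 1 < B →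
      volume (cylinderSet w g v t L A B) ≤ ENNReal.ofReal (C * A ^ m * B ^ K) := by
  obtain ⟨c, hc0, hc1, N, hdio⟩ := exists_diophantine_of_not_isLiouvilleVector hv
  obtain ⟨G, hG, hgG⟩ := exists_norm_mulVec_le (g⁻¹).1
  set C₁ : ℝ := 5 * (10 ^ n * ((5 * (G + 1)) ^ (m + n) *
    (5 * (2 + n * L) * (2 * L) ^ (n - 1) * 2 * (3 * (1 + n * L)) * (2 * G / c)) ^ m)) with hC₁
  set C₂ : ℝ := ((2 * L) ^ n * (2 * G / c)) ^ m with hC₂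
  have hC₁0 : 0 < C₁ := by positivity
  have hC₂0 : 0 < C₂ := by positivity
  refine ⟨C₁ + C₂, by positivity, N * m + 1, by omega, fun t A B ht hA hA1 hB => ?_⟩
  have hBN : 1 ≤ B ^ N := one_le_pow₀ hB.le
  -- As g⁻¹ expands norms by at most G, ‖g(p + qv)‖ ≥ c / (G B^N) = 2a.
  set a : ℝ := c / (2 * G * B ^ N) with ha
  have ha1 : a ≤ 1 := by
    rw [ha, div_le_one (by positivity)]
    nlinarith
  have hainv : 1 / a = 2 * G / c * B ^ N := by rw [ha]; field_simp
  have hlow : ∀ (p : Fin m ⊕ Fin n → ℤ) (q : ℤ), (p ≠ 0 ∨ q ≠ 0) → |(q : ℝ)| ≤ B →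
      2 * a ≤ ‖g.1 *ᵥ fun i => (p i : ℝ) + q * v i‖ := by
    intro p q hpq hq
    have h1 : c ≤ B ^ N * ‖fun i => (p i : ℝ) + q * v i‖ := by
      -- For q = 0 the Diophantine inequality says nothing, but p is a nonzero integer vector, of
      -- norm at least 1 ≥ c.
      by_cases hq0 : q = 0
      · obtain ⟨i, hi⟩ : ∃ i, p i ≠ 0 := by
          by_contra! h
          exact hpq.elim (fun h' => h' (funext h)) fun h' => h' hq0
        have h2 : (1 : ℝ) ≤ ‖fun i => (p i : ℝ) + q * v i‖ := by
          refine le_trans ?_ (norm_le_pi_norm _ i)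
          rw [hq0, Real.norm_eq_abs, Int.cast_zero, zero_mul, add_zero]
          exact_mod_cast Int.one_le_abs hi
        nlinarith
      · exact (hdio p q hq0).trans (by gcongr)
    have h2 := hgG (g.1 *ᵥ fun i => (p i : ℝ) + q * v i)
    have h3 : (g⁻¹).1 * g.1 = 1 := congrArg Subtype.val (inv_mul_cancel g)
    rw [Matrix.mulVec_mulVec, h3, Matrix.one_mulVec] at h2
    have h4 : 2 * a = c / (G * B ^ N) := by rw [ha]; field_simp
    rw [h4, div_le_iff₀ (by positivity)]
    calc c ≤ _ := h1
      _ ≤ B ^ N * (G * ‖g.1 *ᵥ fun i => (p i : ℝ) + q * v i‖) := by gcongr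
      _ = _ := by ring
  rcases le_total A a with hAa | hAa
  · refine (volume_cylinderSet_le_of_norm_le hw hsum ht hL hA hA1 hB hG hgG hAa ha1 hlow).trans
      (ENNReal.ofReal_le_ofReal ?_)
    have h1 : 5 * (2 + n * L) * (2 * L) ^ (n - 1) * 2 * A * (3 * (1 + n * L)) / a =
        5 * (2 + n * L) * (2 * L) ^ (n - 1) * 2 * (3 * (1 + n * L)) * (2 * G / c) *
          (A * B ^ N) := by
      rw [div_eq_mul_one_div, hainv]; ring
    calc _ = C₁ * A ^ m * B ^ (N * m + 1) := by
          rw [h1, mul_pow _ (A * B ^ N), mul_pow A, hC₁, pow_succ, pow_mul]; ring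
      _ ≤ _ := by gcongr; linarith
  -- Here A/a ≥ 1, so the volume of the cube may be multiplied by (A/a)^m.
  · refine (measure_mono fun θ h => h.1).trans ((volume_cube_le hL.le).trans
      (ENNReal.ofReal_le_ofReal ?_))
    have h1 : 1 ≤ 2 * G / c * B ^ N * A := by
      rw [← hainv, one_div_mul_eq_div, one_le_div (by positivity)]; exact hAa
    calc ((2 * L) ^ n) ^ m ≤ ((2 * L) ^ n * (2 * G / c * B ^ N * A)) ^ m := by
          gcongr
          exact le_mul_of_one_le_right (by positivity) h1
      _ = C₂ * A ^ m * B ^ (N * m) * 1 := by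
          rw [hC₂, pow_mul]; simp only [mul_pow]; ring
      _ ≤ C₂ * A ^ m * B ^ (N * m) * B := by gcongr
      _ = C₂ * A ^ m * B ^ (N * m + 1) := by rw [pow_succ]; ring
      _ ≤ _ := by gcongr; linarith

theorem proposition3p1 (m n : ℕ) (hm : 1 ≤ m) (hn : 1 ≤ n)
    (w : Fin m ⊕ Fin n → ℝ) (hw : ∀ i, 0 < w i)
    (hsum : ∑ i : Fin m, w (Sum.inl i) = ∑ j : Fin n, w (Sum.inr j))
    (y : AffineLatticeSpace (Fin m ⊕ Fin n)) (L : ℝ) (hL : 0 < L) :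
    ∃ β₀ β₁ β₂ : ℝ, 0 < β₀ ∧ 0 < β₁ ∧ 0 < β₂ ∧
      ∀ (g : Matrix.SpecialLinearGroup (Fin m ⊕ Fin n) ℝ) (v : Fin m ⊕ Fin n → ℝ),
        y = QuotientGroup.mk
            (affineElt g ((g : Matrix (Fin m ⊕ Fin n) (Fin m ⊕ Fin n) ℝ) *ᵥ v)) →
        ¬ IsLiouvilleVector v →
        ∀ t A B : ℝ, 0 ≤ t → 0 < A → A < 1 → 1 < B →
          MeasureTheory.volume (cylinderSet w g v t L A B) ≤
            ENNReal.ofReal (β₀ * A ^ β₁ * B ^ β₂) := by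
  -- The constants must depend on y alone, so they are taken from one non-Liouville representative,
  -- whose bound passes to all others; if there is none, the claim is vacuous.
  by_cases hex : ∃ (g : Matrix.SpecialLinearGroup (Fin m ⊕ Fin n) ℝ) (v : Fin m ⊕ Fin n → ℝ),
      y = QuotientGroup.mk
          (affineElt g ((g : Matrix (Fin m ⊕ Fin n) (Fin m ⊕ Fin n) ℝ) *ᵥ v)) ∧
        ¬ IsLiouvilleVector v
  · obtain ⟨g₀, v₀, hy₀, hv₀⟩ := hex
    obtain ⟨C, hC, K, hK, hbound⟩ := exists_volume_cylinderSet_le hw hsum g₀ hv₀ hL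
    refine ⟨C, m, K, hC, by exact_mod_cast hm, by exact_mod_cast hK, ?_⟩
    intro g v hy _ t A B ht hA hA1 hB
    rw [Real.rpow_natCast, Real.rpow_natCast]
    exact (measure_mono (cylinderSet_subset_of_mk_eq w (hy₀.symm.trans hy) t L A B)).trans
      (hbound t A B ht hA hA1 hB)
  · exact ⟨1, 1, 1, one_pos, one_pos, one_pos, fun g v hy hv => absurd ⟨g, v, hy, hv⟩ hex⟩
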